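/- An instance of the oracle identification problem (OIP) is a set $S\subseteq\{0,1\}^N$ of $M=|S|$ candidate oracles. A hidden oracle $f\in S$ can be accessed only through oracle calls, i.e. applications of the unitary $U_f|x\rangle|b\rangle=|x\rangle|b\oplus f(x)\rangle$ with $1\le x\le N$ and $b\in\{0,1\}$, and the task is to determine $f$. For a constant $p\in(\tfrac12,1]$, the quantum query complexity $Q_p(S)$ is the least number of oracle calls made by a quantum algorithm (with arbitrary finite working memory and arbitrary unitaries independent of $f$ between the calls) that, for every $f\in S$, outputs $f$ with probability at least $p$ when $f$ is the hidden oracle. Theorem. For every constant $p\in(\tfrac12,1]$ there is a constant $c>0$, depending only on $p$, such that for all integers $N$, $\tilde k$, $M$ with $1\le\tilde k\le N$ and $$\binom{N}{\tilde k-1}+\binom{N}{\tilde k}\;\le\; M\;\le\;\binom{N}{\tilde k}+\binom{N}{\tilde k+1}$$ there is an OIP instance $S\subseteq\{0,1\}^N$ with $|S|=M$ candidates and $$Q_p(S)\;\ge\; c\,\sqrt{(N-\tilde k)(\tilde k+1)} .$$ That is, some OIP with $M$ candidates has quantum query complexity $\Omega\bigl(\sqrt{(N-\tilde k)(\tilde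 k+1)}\bigr)$. -/

import Mathlib

namespace OracleIdentification

/-- Computational basis of the register of a quantum query algorithm: a bit position of the
oracle, an answer bit, and one of `d` basis states of the working memory. -/
abbrev Basis (N d : ℕ) : Type := Fin N × Bool × Fin d

/-- The state space of a quantum query algorithm. -/
abbrev State (N d : ℕ) : Type := EuclideanSpace ℂ (Basis N d)

/-- The action of an oracle call to `f` on basis states: `(x, b, z) ↦ (x, b ⊕ f x, z)`. -/
def oraclePerm {N : ℕ} (d : ℕ) (f : Fin N → Bool) : Equiv.Perm (Basis N d) :=
  Function.Involutive.toPerm (fun s => (s.1, xor s.2.1 (f s.1), s.2.2))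
    (by rintro ⟨x, b, z⟩; simp)

theorem oraclePerm_apply {N d : ℕ} (f : Fin N → Bool) (x : Fin N) (b : Bool) (z : Fin d) :
    oraclePerm d f (x, b, z) = (x, xor b (f x), z) := rfl

/-- The oracle call `U_f`: the unitary transformation with `U_f |x⟩|b⟩|z⟩ = |x⟩|b ⊕ f x⟩|z⟩`. -/
noncomputable def oracleCall {N : ℕ} (d : ℕ) (f : Fin N → Bool) :
    State N d ≃ₗᵢ[ℂ] State N d :=
  LinearIsometryEquiv.piLpCongrLeft 2 ℂ ℂ (oraclePerm d f)

/-- A quantum algorithm that makes `T` oracle calls to a hidden `N`-bit oracle, with a working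
memory of dimension `d`: an initial unit vector, a unitary transformation to be applied after each
oracle call, and the name of the oracle to be announced for each result of the measurement in the
computational basis at the end.  None of these depends on the hidden oracle. -/
structure QueryAlgorithm (N d T : ℕ) where
  /-- the state before the first oracle call -/
  init : State N d
  norm_init : ‖init‖ = 1
  /-- `gate t` is applied after oracle call number `t`, counted from `0` -/
  gate : Fin T → (State N d ≃ₗᵢ[ℂ] State N d)
  /-- the answer announced for each measurement result -/
  answer : Basis N d → (Fin N → Bool)

namespace QueryAlgorithm

variable {N d T : ℕ}

/-- The state after `t ≤ T` oracle calls to `f`, each followed by its gate. -/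
noncomputable def stateAfter (A : QueryAlgorithm N d T) (f : Fin N → Bool) :
    (t : ℕ) → t ≤ T → State N d
  | 0, _ => A.init
  | t + 1, h => A.gate ⟨t, h⟩ (oracleCall d f (A.stateAfter f t (Nat.le_of_succ_le h)))

/-- The probability that the algorithm announces `f` when the hidden oracle is `f`. -/
noncomputable def successProb (A : QueryAlgorithm N d T) (f : Fin N → Bool) : ℝ :=
  ∑ s : Basis N d, if A.answer s = f then ‖A.stateAfter f T le_rfl s‖ ^ 2 else 0

end QueryAlgorithm

/-- The oracle identification problem with candidate set `S` can be solved with success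
probability at least `p`, whichever candidate is hidden, by `T` oracle calls. -/
def SolvableWith {N : ℕ} (S : Finset (Fin N → Bool)) (p : ℝ) (T : ℕ) : Prop :=
  ∃ (d : ℕ) (A : QueryAlgorithm N d T), ∀ f ∈ S, p ≤ A.successProb f

/-- The quantum query complexity of the oracle identification problem with candidate set `S`, for
success probability `p`: the least number of oracle calls that suffices.  The minimum is attained
for `0 < N` and `p ≤ 1`, see `solvableWith_self`. -/
noncomputable def queryComplexity {N : ℕ} (S : Finset (Fin N → Bool)) (p : ℝ) : ℕ :=
  sInf {T : ℕ | SolvableWith S p T}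

/-- Reading all the `N` bits one by one identifies the oracle with certainty. -/
theorem solvableWith_self {N : ℕ} (hN : 0 < N) (S : Finset (Fin N → Bool)) {p : ℝ} (hp : p ≤ 1) :
    SolvableWith S p N := by
  have : NeZero N := ⟨hN.ne'⟩
  let e := (Fintype.equivFin (Fin N → Bool)).symm
  let store : Equiv.Perm (Basis N (Fintype.card (Fin N → Bool))) :=
    Function.Involutive.toPerm
      (fun s => (s.1, e s.2.2 s.1, e.symm (Function.update (e s.2.2) s.1 s.2.1)))
      (by rintro ⟨x, b, z⟩; simp)
  let next : Equiv.Perm (Basis N (Fintype.card (Fin N → Bool))) :=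
    Equiv.prodCongr (Equiv.addRight (1 : Fin N)) (Equiv.refl _)
  let A : QueryAlgorithm N (Fintype.card (Fin N → Bool)) N :=
    { init := EuclideanSpace.single (0, false, e.symm fun _ => false) 1
      norm_init := by simp
      gate := fun _ => LinearIsometryEquiv.piLpCongrLeft 2 ℂ ℂ (store.trans next)
      answer := fun s => e s.2.2 }
  have key : ∀ (f : Fin N → Bool) (t : ℕ) (h : t ≤ N), A.stateAfter f t h =
      EuclideanSpace.single (Fin.ofNat N t, false,
        e.symm fun i => if (i : ℕ) < t then f i else false) 1 := by
    intro f t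
    induction t with
    | zero => intro h; simp [QueryAlgorithm.stateAfter, A]
    | succ t ih =>
      intro h
      have hx : ((Fin.ofNat N t : Fin N) : ℕ) = t := Nat.mod_eq_of_lt h
      have h1 : (store.trans next) (oraclePerm (Fintype.card (Fin N → Bool)) f
          (Fin.ofNat N t, false, e.symm fun i => if (i : ℕ) < t then f i else false)) =
          (Fin.ofNat N (t + 1), false,
            e.symm fun i => if (i : ℕ) < t + 1 then f i else false) := by
        have h2 : store (oraclePerm (Fintype.card (Fin N → Bool)) f
            (Fin.ofNat N t, false, e.symm fun i => if (i : ℕ) < t then f i else false)) =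
            (Fin.ofNat N t, false, e.symm (Function.update
              (fun i => if (i : ℕ) < t then f i else false) (Fin.ofNat N t)
              (f (Fin.ofNat N t)))) := by
          rw [oraclePerm_apply]
          change (_, e (e.symm _) _, e.symm (Function.update (e (e.symm _)) _ _)) = _
          rw [Equiv.apply_symm_apply]
          simp only [hx, lt_irrefl, if_false, Bool.false_xor]
        rw [Equiv.trans_apply, h2]
        refine Prod.ext ?_ (Prod.ext rfl ?_)
        · change Fin.ofNat N t + 1 = Fin.ofNat N (t + 1)
          apply Fin.ext
          rw [Fin.val_add]
          simp
        · refine congrArg e.symm (funext fun i => ?_)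
          by_cases hi : i = Fin.ofNat N t
          · subst hi; rw [Function.update_self, if_pos (by omega)]
          · have : (i : ℕ) ≠ t := fun h' => hi (Fin.ext (h'.trans hx.symm))
            rw [Function.update_of_ne hi]
            congr 1
            apply propext; omega
      rw [QueryAlgorithm.stateAfter, ih]
      simp only [oracleCall, A, EuclideanSpace.piLpCongrLeft_single, h1]
  refine ⟨_, A, fun f _ => hp.trans (le_of_eq ?_)⟩
  rw [QueryAlgorithm.successProb, key]
  rw [Finset.sum_eq_single (Fin.ofNat N N, false, e.symm f)]
  · simp [A]
  · intro s _ hs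
    have hs' : s ≠ (Fin.ofNat N N, false, e.symm fun i => if (i : ℕ) < N then f i else false) := by
      simpa using hs
    rw [PiLp.single_apply, if_neg hs']
    simp
  · simp

end OracleIdentification

namespace OracleIdentification

open Finset

variable {N d T : ℕ}

/-! With `l = k - 1`, let `S` contain the layers of weight `l` and `l + 1` of the hypercube, padded
to size `M`; the upper bound on `M` serves only to give `M ≤ 2 ^ N`. The lower bound is an adversary
argument on the edges between the two layers. The progress measure is the sum over edges of the
squared distance between the algorithm's states for the two endpoints. It starts at 0 and must end
at least a constant times the number of edges (`le_norm_stateAfter_sub`). The endpoints differ in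
one bit, so a call changes their distance only through the weight queried there
(`norm_oracleCall_sub_sq_le`). The query weights of a state sum to 1, so a call's total gain is
bounded by the sizes of the layers, weighted by `s` and `s⁻¹`. Balancing `s` against the degrees `N
- l` and `l + 1` gives `adversary_bound`. -/

theorem oracleCall_apply (f : Fin N → Bool) (φ : State N d) (x : Fin N) (b : Bool) (z : Fin d) :
    oracleCall d f φ (x, b, z) = φ (x, xor b (f x), z) := rfl

/-! ### Query weights and the effect of one call -/

/-- The probability that position `x` is queried in the state `φ`. -/
noncomputable def queryWeight (φ : State N d) (x : Fin N) : ℝ :=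
  ∑ b : Bool, ∑ z : Fin d, ‖φ (x, b, z)‖ ^ 2

theorem queryWeight_nonneg (φ : State N d) (x : Fin N) : 0 ≤ queryWeight φ x := by
  unfold queryWeight; positivity

theorem norm_sq_eq_sum (φ : State N d) :
    ‖φ‖ ^ 2 = ∑ x : Fin N, ∑ b : Bool, ∑ z : Fin d, ‖φ (x, b, z)‖ ^ 2 := by
  rw [EuclideanSpace.norm_sq_eq, Fintype.sum_prod_type]
  simp_rw [Fintype.sum_prod_type]

theorem sum_queryWeight (φ : State N d) : ∑ x, queryWeight φ x = ‖φ‖ ^ 2 :=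
  (norm_sq_eq_sum φ).symm

theorem sum_xor {β : Type*} [AddCommMonoid β] (F : Bool → β) (c : Bool) :
    ∑ b, F (xor b c) = ∑ b, F b := by
  cases c <;> simp [add_comm]

theorem queryWeight_oracleCall (f : Fin N → Bool) (φ : State N d) (x : Fin N) :
    queryWeight (oracleCall d f φ) x = queryWeight φ x := by
  simp only [queryWeight, oracleCall_apply]
  exact sum_xor (fun b => ∑ z : Fin d, ‖φ (x, b, z)‖ ^ 2) (f x)

theorem two_mul_le_weighted {s : ℝ} (hs : 0 < s) (a b : ℝ) :
    2 * (a * b) ≤ s * a ^ 2 + s⁻¹ * b ^ 2 := by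
  have h : s * a ^ 2 + s⁻¹ * b ^ 2 - 2 * (a * b) = s⁻¹ * (s * a - b) ^ 2 := by
    field_simp; ring
  have : 0 ≤ s⁻¹ * (s * a - b) ^ 2 := by positivity
  linarith

theorem queryWeight_sub_le {s : ℝ} (hs : 0 < s) (φ ψ : State N d) (x : Fin N) :
    queryWeight (φ - ψ) x ≤ (1 + s) * queryWeight φ x + (1 + s⁻¹) * queryWeight ψ x := by
  simp only [queryWeight, mul_sum, ← sum_add_distrib]
  refine sum_le_sum fun b _ => sum_le_sum fun z _ => ?_
  have h1 := norm_sub_le (φ (x, b, z)) (ψ (x, b, z))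
  have h2 := two_mul_le_weighted hs ‖φ (x, b, z)‖ ‖ψ (x, b, z)‖
  have h3 := pow_le_pow_left₀ (norm_nonneg _) h1 2
  rw [PiLp.sub_apply]
  linarith

theorem le_queryWeight_sub {s : ℝ} (hs : 0 < s) (φ ψ : State N d) (x : Fin N) :
    (1 - s) * queryWeight φ x + (1 - s⁻¹) * queryWeight ψ x ≤ queryWeight (φ - ψ) x := by
  simp only [queryWeight, mul_sum, ← sum_add_distrib]
  refine sum_le_sum fun b _ => sum_le_sum fun z _ => ?_
  have h1 := abs_norm_sub_norm_le (φ (x, b, z)) (ψ (x, b, z))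
  have h2 := two_mul_le_weighted hs ‖φ (x, b, z)‖ ‖ψ (x, b, z)‖
  have h3 := pow_le_pow_left₀ (abs_nonneg _) h1 2
  rw [sq_abs] at h3
  rw [PiLp.sub_apply]
  linarith

/-- One call to two oracles that differ at most at `i` increases the squared distance of two states
by no more than their weights at `i` allow. -/
theorem norm_oracleCall_sub_sq_le {s : ℝ} (hs : 0 < s) {f g : Fin N → Bool} {i : Fin N}
    (hfg : ∀ x, x ≠ i → f x = g x) (φ ψ : State N d) :
    ‖oracleCall d f φ - oracleCall d g ψ‖ ^ 2 ≤
      ‖φ - ψ‖ ^ 2 + 2 * (s * queryWeight φ i + s⁻¹ * queryWeight ψ i) := by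
  rw [← sum_queryWeight, ← sum_queryWeight (φ - ψ),
    ← add_sum_erase univ _ (mem_univ i), ← add_sum_erase univ _ (mem_univ i)]
  have h1 := queryWeight_sub_le hs (oracleCall d f φ) (oracleCall d g ψ) i
  rw [queryWeight_oracleCall, queryWeight_oracleCall] at h1
  have h2 := le_queryWeight_sub hs φ ψ i
  -- Away from `i` both calls permute amplitudes identically. At `i`, the upper bound `h1` minus the
  -- lower bound `h2` leaves only the terms in `s` and `s⁻¹`.
  have h3 : ∑ x ∈ univ.erase i, queryWeight (oracleCall d f φ - oracleCall d g ψ) x =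
      ∑ x ∈ univ.erase i, queryWeight (φ - ψ) x := by
    refine sum_congr rfl fun x hx => ?_
    rw [← queryWeight_oracleCall f (φ - ψ) x]
    simp only [queryWeight, PiLp.sub_apply, oracleCall_apply, hfg x (ne_of_mem_erase hx)]
  linarith

/-! ### Runs of one algorithm on two oracles -/

namespace QueryAlgorithm

theorem norm_stateAfter (A : QueryAlgorithm N d T) (f : Fin N → Bool) :
    ∀ (t : ℕ) (h : t ≤ T), ‖A.stateAfter f t h‖ = 1
  | 0, _ => A.norm_init
  | t + 1, h => by
    rw [stateAfter, LinearIsometryEquiv.norm_map, LinearIsometryEquiv.norm_map]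
    exact norm_stateAfter A f t _

theorem norm_stateAfter_succ_sub_sq_le (A : QueryAlgorithm N d T) {s : ℝ} (hs : 0 < s)
    {f g : Fin N → Bool} {i : Fin N} (hfg : ∀ x, x ≠ i → f x = g x) (t : ℕ) (h : t + 1 ≤ T) :
    ‖A.stateAfter f (t + 1) h - A.stateAfter g (t + 1) h‖ ^ 2 ≤
      ‖A.stateAfter f t (Nat.le_of_succ_le h) - A.stateAfter g t (Nat.le_of_succ_le h)‖ ^ 2 +
        2 * (s * queryWeight (A.stateAfter f t (Nat.le_of_succ_le h)) i +
          s⁻¹ * queryWeight (A.stateAfter g t (Nat.le_of_succ_le h)) i) := by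
  rw [stateAfter, stateAfter, ← map_sub, LinearIsometryEquiv.norm_map]
  exact norm_oracleCall_sub_sq_le hs hfg _ _

/-- The final states for two oracles that are both identified with probability `p` are far apart. -/
theorem le_norm_stateAfter_sub (A : QueryAlgorithm N d T) {p : ℝ} (hp : 1 / 2 < p)
    {f g : Fin N → Bool} (hne : f ≠ g) (hf : p ≤ A.successProb f) (hg : p ≤ A.successProb g) :
    (√p - √(1 - p)) ^ 2 ≤ ‖A.stateAfter f T le_rfl - A.stateAfter g T le_rfl‖ ^ 2 := by
  set φ := A.stateAfter f T le_rfl with hφ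
  set ψ := A.stateAfter g T le_rfl with hψ
  -- `P` projects onto the results announced as `f`; it keeps much of `φ`, little of `ψ`, and does
  -- not increase distances.
  let P : State N d → State N d := fun χ => WithLp.toLp 2 fun s => if A.answer s = f then χ s else 0
  have hP : ∀ χ, ‖P χ‖ ^ 2 = ∑ s, if A.answer s = f then ‖χ s‖ ^ 2 else 0 := by
    intro χ
    rw [EuclideanSpace.norm_sq_eq]
    refine sum_congr rfl fun s _ => ?_
    by_cases h : A.answer s = f <;> simp [P, h]
  have hPφ : √p ≤ ‖P φ‖ := by
    refine Real.sqrt_le_iff.2 ⟨norm_nonneg _, ?_⟩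
    rw [hP]; exact hf
  have hPψ : ‖P ψ‖ ≤ √(1 - p) := by
    refine Real.le_sqrt_of_sq_le ?_
    have h1 : ∑ s, ‖ψ s‖ ^ 2 = 1 := by
      rw [← EuclideanSpace.norm_sq_eq, hψ, norm_stateAfter, one_pow]
    -- Announcing `f` and announcing `g` are disjoint events.
    have h2 : ‖P ψ‖ ^ 2 + A.successProb g ≤ ∑ s, ‖ψ s‖ ^ 2 := by
      rw [hP, successProb, ← sum_add_distrib]
      refine sum_le_sum fun s _ => ?_
      by_cases h : A.answer s = f
      · simp [h, hne]
      · by_cases h' : A.answer s = g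
        · simp [h', hne.symm, hψ]
        · simp [h, h']
    linarith
  have hsub : ‖P φ - P ψ‖ ≤ ‖φ - ψ‖ := by
    refine le_of_sq_le_sq ?_ (norm_nonneg _)
    rw [EuclideanSpace.norm_sq_eq, EuclideanSpace.norm_sq_eq]
    refine sum_le_sum fun s _ => ?_
    by_cases h : A.answer s = f <;> simp [P, h]
  have htri := norm_sub_norm_le (P φ) (P ψ)
  have h0 : √(1 - p) ≤ √p := Real.sqrt_le_sqrt (by linarith)
  exact pow_le_pow_left₀ (by linarith) (by linarith) 2

end QueryAlgorithm

/-! ### The adversary argument on two adjacent layers -/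

/-- The oracle that is `true` exactly on `A`. -/
def ofFinset (A : Finset (Fin N)) : Fin N → Bool := fun i => decide (i ∈ A)

theorem ofFinset_injective : Function.Injective (ofFinset (N := N)) := by
  intro A B h
  ext i
  simpa [ofFinset] using congrFun h i

/-- Double counting of the edges between two adjacent layers of the hypercube. -/
theorem sum_powersetCard_insert {β : Type*} [AddCommMonoid β] (l : ℕ)
    (F : Finset (Fin N) → Fin N → β) :
    ∑ A ∈ powersetCard l univ, ∑ i ∈ Aᶜ, F (insert i A) i =
      ∑ B ∈ powersetCard (l + 1) univ, ∑ i ∈ B, F B i := by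
  rw [sum_sigma', sum_sigma']
  refine sum_bij' (fun q _ => ⟨insert q.2 q.1, q.2⟩) (fun q _ => ⟨q.1.erase q.2, q.2⟩) ?_ ?_ ?_ ?_ ?_
  · rintro ⟨A, i⟩ h
    simp only [mem_sigma, mem_powersetCard_univ, mem_compl] at h ⊢
    exact ⟨by rw [card_insert_of_notMem h.2, h.1], mem_insert_self _ _⟩
  · rintro ⟨B, i⟩ h
    simp only [mem_sigma, mem_powersetCard_univ, mem_compl] at h ⊢
    exact ⟨by rw [card_erase_of_mem h.2, h.1, Nat.add_sub_cancel], notMem_erase _ _⟩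
  · rintro ⟨A, i⟩ h
    simp only [mem_sigma, mem_compl] at h
    simp [erase_insert h.2]
  · rintro ⟨B, i⟩ h
    simp only [mem_sigma] at h
    simp [insert_erase h.2]
  · rintro ⟨A, i⟩ _
    rfl

/-- The ratio `a / b` makes the two terms of the gain per call equal, since `x * a ^ 2 = y * b ^ 2`.
-/
theorem le_four_mul_of_balanced {a b x y δ τ : ℝ} (ha : 0 < a) (hb : 0 < b) (hx : 0 < x)
    (hxy : x * a ^ 2 = y * b ^ 2)
    (h : x * a ^ 2 * δ ≤ τ * (2 * (a / b * x + (a / b)⁻¹ * y))) : δ * (a * b) ≤ 4 * τ := by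
  have hy : y = x * a ^ 2 / b ^ 2 := by
    rw [hxy]; field_simp
  have h1 : x * a ^ 2 * δ = x * (a / b) * (δ * (a * b)) := by field_simp
  have h2 : τ * (2 * (a / b * x + (a / b)⁻¹ * y)) = x * (a / b) * (4 * τ) := by
    rw [hy]; field_simp; ring
  rw [h1, h2] at h
  exact le_of_mul_le_mul_left h (by positivity)

/-- The adversary bound for the layers of weight `l` and `l + 1` of the hypercube. -/
theorem adversary_bound {S : Finset (Fin N → Bool)} {p : ℝ} (hp : 1 / 2 < p) {l : ℕ} (hl : l < N)
    (h₀ : ∀ A : Finset (Fin N), #A = l → ofFinset A ∈ S)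
    (h₁ : ∀ A : Finset (Fin N), #A = l + 1 → ofFinset A ∈ S) (hT : SolvableWith S p T) :
    (√p - √(1 - p)) ^ 2 * √((N - l : ℝ) * (l + 1)) ≤ 4 * T := by
  obtain ⟨d, Q, hQ⟩ := hT
  set δ := (√p - √(1 - p)) ^ 2
  have hm : (0 : ℝ) < N - l := sub_pos.2 (by exact_mod_cast hl)
  have hl1 : (0 : ℝ) < l + 1 := by positivity
  set m : ℝ := N - l
  set s : ℝ := √m / √(l + 1)
  have hs : 0 < s := by positivity
  set X : Finset (Finset (Fin N)) := powersetCard l univ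
  set Y : Finset (Finset (Fin N)) := powersetCard (l + 1) univ
  have hX : 0 < (#X : ℝ) := by
    rw [card_powersetCard, card_univ, Fintype.card_fin]
    exact_mod_cast Nat.choose_pos hl.le
  have hR : ∀ c : ℝ, ∑ A ∈ X, ∑ _i ∈ Aᶜ, c = #X * m * c := by
    intro c
    have : ∀ A ∈ X, ∑ _i ∈ Aᶜ, c = m * c := by
      intro A hA
      rw [sum_const, card_compl, mem_powersetCard_univ.1 hA, Fintype.card_fin, nsmul_eq_mul,
        Nat.cast_sub hl.le]
    rw [sum_congr rfl this, sum_const, nsmul_eq_mul, mul_assoc]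
  have hXY : #X * m = #Y * (l + 1 : ℝ) := by
    have h := sum_powersetCard_insert l (fun (_ : Finset (Fin N)) (_ : Fin N) => (1 : ℝ))
    rw [hR 1, mul_one] at h
    rw [h, sum_congr rfl fun B hB => by
      rw [sum_const, mem_powersetCard_univ.1 hB, nsmul_eq_mul, mul_one], sum_const, nsmul_eq_mul]
    push_cast; rfl
  -- The progress measure; the pairs `(A, i)` run over the edges between the layers.
  let E : (t : ℕ) → t ≤ T → ℝ := fun t h => ∑ A ∈ X, ∑ i ∈ Aᶜ,
    ‖Q.stateAfter (ofFinset A) t h - Q.stateAfter (ofFinset (insert i A)) t h‖ ^ 2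
  have hw : ∀ (B I : Finset (Fin N)) (t : ℕ) (h : t ≤ T),
      ∑ i ∈ I, queryWeight (Q.stateAfter (ofFinset B) t h) i ≤ 1 := by
    intro B I t h
    refine (sum_le_univ_sum_of_nonneg fun i => queryWeight_nonneg _ i).trans_eq ?_
    rw [sum_queryWeight, Q.norm_stateAfter, one_pow]
  have hstep : ∀ (t : ℕ) (h : t + 1 ≤ T),
      E (t + 1) h ≤ E t (Nat.le_of_succ_le h) + 2 * (s * #X + s⁻¹ * #Y) := by
    intro t h
    have h' := Nat.le_of_succ_le h
    have e1 : E (t + 1) h ≤ ∑ A ∈ X, ∑ i ∈ Aᶜ,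
        (‖Q.stateAfter (ofFinset A) t h' - Q.stateAfter (ofFinset (insert i A)) t h'‖ ^ 2 +
        2 * (s * queryWeight (Q.stateAfter (ofFinset A) t h') i +
          s⁻¹ * queryWeight (Q.stateAfter (ofFinset (insert i A)) t h') i)) := by
      refine sum_le_sum fun A _ => sum_le_sum fun i _ => ?_
      refine Q.norm_stateAfter_succ_sub_sq_le hs (fun x hx => ?_) t h
      simp [ofFinset, hx]
    have e2 : ∑ A ∈ X, ∑ i ∈ Aᶜ, queryWeight (Q.stateAfter (ofFinset A) t h') i ≤ #X := by
      refine (sum_le_card_nsmul X _ 1 fun A _ => hw A _ t h').trans_eq (by simp)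
    -- Regrouped by upper endpoint, the edges at each `B` carry total weight at most 1.
    have e3 : ∑ A ∈ X, ∑ i ∈ Aᶜ,
        queryWeight (Q.stateAfter (ofFinset (insert i A)) t h') i ≤ #Y := by
      rw [sum_powersetCard_insert l fun B i => queryWeight (Q.stateAfter (ofFinset B) t h') i]
      refine (sum_le_card_nsmul Y _ 1 fun A _ => hw A _ t h').trans_eq (by simp)
    simp only [sum_add_distrib, ← mul_sum] at e1
    have e4 := mul_le_mul_of_nonneg_left e2 hs.le
    have e5 := mul_le_mul_of_nonneg_left e3 (inv_pos.2 hs).le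
    change _ ≤ E t h' + _ at e1
    linarith
  have hE : ∀ (t : ℕ) (h : t ≤ T), E t h ≤ t * (2 * (s * #X + s⁻¹ * #Y)) := by
    intro t
    induction t with
    | zero => intro h; simp [E, QueryAlgorithm.stateAfter]
    | succ t ih =>
      intro h
      have := hstep t h
      have := ih (Nat.le_of_succ_le h)
      push_cast
      linarith
  have hfinal : #X * m * δ ≤ E T le_rfl := by
    rw [← hR]
    refine sum_le_sum fun A hA => sum_le_sum fun i hi => ?_
    rw [mem_powersetCard_univ] at hA
    rw [mem_compl] at hi
    refine Q.le_norm_stateAfter_sub hp (fun h => hi ?_) (hQ _ (h₀ A hA))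
      (hQ _ (h₁ _ (by rw [card_insert_of_notMem hi, hA])))
    rw [ofFinset_injective h]
    exact mem_insert_self _ _
  have hmain := hfinal.trans (hE T le_rfl)
  rw [Real.sqrt_mul hm.le]
  refine le_four_mul_of_balanced (y := #Y) (Real.sqrt_pos.2 hm) (Real.sqrt_pos.2 hl1) hX ?_ ?_
  · rw [Real.sq_sqrt hm.le, Real.sq_sqrt hl1.le, hXY]
  · rw [Real.sq_sqrt hm.le]
    exact hmain

/-- Any size between that of two layers of the hypercube and that of the whole hypercube is the
size of a set of oracles that contains both layers. -/
theorem exists_layers_subset_card_eq (N l M : ℕ) (h : N.choose l + N.choose (l + 1) ≤ M)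
    (hM : M ≤ 2 ^ N) :
    ∃ S : Finset (Fin N → Bool), #S = M ∧
      (∀ A : Finset (Fin N), #A = l → ofFinset A ∈ S) ∧
      ∀ A : Finset (Fin N), #A = l + 1 → ofFinset A ∈ S := by
  let L : Finset (Fin N → Bool) :=
    (powersetCard l univ ∪ powersetCard (l + 1) univ).image ofFinset
  have hL : #L ≤ M := by
    refine (card_image_le.trans (card_union_le _ _)).trans ?_
    simpa only [card_powersetCard, card_univ, Fintype.card_fin] using h
  obtain ⟨S, hLS, -, hS⟩ := exists_subsuperset_card_eq (subset_univ L) hL (by simpa using hM)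
  exact ⟨S, hS, fun A hA => hLS (mem_image_of_mem _ (by simp [hA])),
    fun A hA => hLS (mem_image_of_mem _ (by simp [hA]))⟩

theorem choose_add_choose_succ_le_two_pow (N k : ℕ) :
    N.choose k + N.choose (k + 1) ≤ 2 ^ N := by
  -- Terms beyond the range vanish, so `k` needs no bound.
  have h := sum_le_sum_of_ne_zero (s := {k, k + 1}) (t := range (N + 1)) (f := N.choose)
    fun x _ hx => mem_range.2 (Nat.lt_succ_of_le (Nat.choose_ne_zero_iff.1 hx))
  rwa [sum_pair k.succ_ne_self.symm, Nat.sum_range_choose] at h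

end OracleIdentification

theorem mainTheorem4 (p : ℝ) (hp : 1 / 2 < p) (hp1 : p ≤ 1) :
    ∃ c : ℝ, 0 < c ∧
      ∀ N k M : ℕ, 1 ≤ k → k ≤ N →
        N.choose (k - 1) + N.choose k ≤ M →
        M ≤ N.choose k + N.choose (k + 1) →
        ∃ S : Finset (Fin N → Bool), S.card = M ∧
          c * Real.sqrt (((N : ℝ) - k) * ((k : ℝ) + 1)) ≤
            (OracleIdentification.queryComplexity S p : ℝ) := by
  have hδ : 0 < √p - √(1 - p) := sub_pos.2 (Real.sqrt_lt_sqrt (by linarith) (by linarith))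
  -- The 8 is the 4 of `adversary_bound` times the 2 lost in `hsqrt` by passing from `k` to `l = k -
  -- 1`.
  refine ⟨(√p - √(1 - p)) ^ 2 / 8, by positivity, fun N k M hk hkN hM₁ hM₂ => ?_⟩
  obtain ⟨l, rfl⟩ : ∃ l, k = l + 1 := ⟨k - 1, by omega⟩
  obtain ⟨S, hS, h₀, h₁⟩ := OracleIdentification.exists_layers_subset_card_eq N l M hM₁
    (hM₂.trans (OracleIdentification.choose_add_choose_succ_le_two_pow N (l + 1)))
  refine ⟨S, hS, ?_⟩
  -- `sInf ∅ = 0` in `ℕ`, so the minimum is attained only because some number of calls suffices.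
  have hsolv : OracleIdentification.SolvableWith S p (OracleIdentification.queryComplexity S p) :=
    Nat.sInf_mem (s := {T : ℕ | OracleIdentification.SolvableWith S p T})
      ⟨N, OracleIdentification.solvableWith_self (by omega) S hp1⟩
  have hbound := OracleIdentification.adversary_bound hp (Nat.lt_of_succ_le hkN) h₀ h₁ hsolv
  have hN : (l : ℝ) + 1 ≤ N := by exact_mod_cast hkN
  have hsqrt : √(((N : ℝ) - (l + 1 : ℕ)) * ((l + 1 : ℕ) + 1)) ≤
      2 * √(((N : ℝ) - l) * (l + 1)) := by
    refine Real.sqrt_le_iff.2 ⟨by positivity, ?_⟩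
    have hl : (0 : ℝ) ≤ l := l.cast_nonneg
    rw [mul_pow, Real.sq_sqrt (mul_nonneg (by linarith) (by positivity))]
    push_cast
    nlinarith [mul_nonneg (sub_nonneg.2 hN) hl]
  have := mul_le_mul_of_nonneg_left hsqrt (sq_nonneg (√p - √(1 - p)))
  linarith
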